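/- For a compact Hausdorff space $X$ (possibly empty), let $C(X)$ be the set of continuous real-valued functions on $X$, write $c_X$ for the constant function with value $c$, and write $\vee,\wedge$ for (pointwise) maximum and minimum. A max-min measure on $X$ is a functional $\mu\colon C(X)\to\mathbb R$ (not assumed continuous) such that $\mu(c_X)=c$, $\mu(\varphi\vee\psi)=\mu(\varphi)\vee\mu(\psi)$ and $\mu(c_X\wedge\varphi)=c\wedge\mu(\varphi)$ for all $c\in\mathbb R$ and $\varphi,\psi\in C(X)$. Let $J(X)$ be the set of all max-min measures on $X$, with the topology of pointwise convergence on $C(X)$. A continuous map $f\colon X\to Y$ of compact Hausdorff spaces induces $J(f)\colon J(X)\to J(Y)$, $J(f)(\mu)(\varphi)=\mu(\varphi\circ f)$. For a closed set $A\subseteq X$, identify $J(A)$ with its image in $J(X)$ under the map induced by the inclusion $A\hookrightarrow X$. The support of $\mu\in J(X)$ is $\operatorname{supp}(\mu)=\bigcap\{A\subseteq X : A\text{ nonempty and compact},\ \mu\in J(A)\}$, and $J_\omega(X)=\{\mu\in J(X):\operatorname{supp}(\mu)\text{ is finite}\}$. A space is zero-dimensional if its topology has a base of clopen sets. A continuous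 map $f\colon Z\to X$ of compact Hausdorff spaces is a max-min Milyutin map if there is a continuous map $s\colon X\to J(Z)$ with $s(x)\in J(f^{-1}(x))\subseteq J(Z)$ for every $x\in X$. Theorem. Let $X$ be a compact Hausdorff space. (1) There are a zero-dimensional compact Hausdorff space $Z$ and a max-min Milyutin map $f\colon Z\to X$. (2) For every compact Hausdorff space $Z$ and every max-min Milyutin map $f\colon Z\to X$, the map $J(f)\colon J(Z)\to J(X)$ is onto. (3) The set $J_\omega(X)$ is dense in $J(X)$. -/

import Mathlib

universe u v

/-- A max-min measure on `X`: a functional `μ : C(X, ℝ) → ℝ` (no continuity is required) such that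
`μ c_X = c`, `μ (φ ∨ ψ) = μ φ ∨ μ ψ` and `μ (c ∧ φ) = c ∧ μ φ`.  The type of all of them
is the space `J(X)`. -/
structure MaxMinMeasure (X : Type u) [TopologicalSpace X] where
  toFun : C(X, ℝ) → ℝ
  map_const' : ∀ c : ℝ, toFun (ContinuousMap.const X c) = c
  map_sup' : ∀ φ ψ : C(X, ℝ), toFun (φ ⊔ ψ) = toFun φ ⊔ toFun ψ
  map_const_inf' : ∀ (c : ℝ) (φ : C(X, ℝ)), toFun (ContinuousMap.const X c ⊓ φ) = c ⊓ toFun φ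

namespace MaxMinMeasure

variable {X : Type u} {Y : Type v} [TopologicalSpace X] [TopologicalSpace Y]

/-- The weak* topology on `J(X)`: the topology of pointwise convergence on `C(X, ℝ)`. -/
instance instTopologicalSpace : TopologicalSpace (MaxMinMeasure X) :=
  TopologicalSpace.induced (fun μ : MaxMinMeasure X => μ.toFun) inferInstance

/-- The push-forward `J(f) : J(X) → J(Y)`, `J(f)(μ)(φ) = μ(φ ∘ f)`. -/
def map (f : C(X, Y)) (μ : MaxMinMeasure X) : MaxMinMeasure Y where
  toFun φ := μ.toFun (φ.comp f)
  map_const' c := μ.map_const' c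
  map_sup' φ ψ := μ.map_sup' (φ.comp f) (ψ.comp f)
  map_const_inf' c φ := μ.map_const_inf' c (φ.comp f)

/-- `J(A)` regarded as a subset of `J(X)`, for a closed subspace `A` of `X`: the image of the map
`J(i) : J(A) → J(X)` induced by the inclusion `i : A → X`. -/
def concentratedOn (A : Set X) : Set (MaxMinMeasure X) :=
  Set.range (map (⟨Subtype.val, continuous_subtype_val⟩ : C(A, X)))

/-- The support of `μ`: the intersection of all nonempty compact `A ⊆ X` with `μ ∈ J(A)`. -/
def supp (μ : MaxMinMeasure X) : Set X :=
  ⋂₀ {A : Set X | A.Nonempty ∧ IsCompact A ∧ μ ∈ concentratedOn A}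

/-- `J_ω(X)`: the set of max-min measures of finite support. -/
def finiteSupport (X : Type u) [TopologicalSpace X] : Set (MaxMinMeasure X) :=
  {μ | μ.supp.Finite}

end MaxMinMeasure

/-- A space is zero-dimensional if its topology has a base that consists of clopen sets. -/
def IsZeroDimensional (Z : Type u) [TopologicalSpace Z] : Prop :=
  ∃ B : Set (Set Z), TopologicalSpace.IsTopologicalBasis B ∧ ∀ U ∈ B, IsClopen U

/-- A continuous map `f : Z → X` is a max-min Milyutin map if there is a continuous map
`s : X → J(Z)` with `s(x) ∈ J(f⁻¹(x)) ⊆ J(Z)` for every `x`. -/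
def IsMaxMinMilyutin {Z : Type u} {X : Type v} [TopologicalSpace Z] [TopologicalSpace X]
    (f : C(Z, X)) : Prop :=
  ∃ s : X → MaxMinMeasure Z, Continuous s ∧ ∀ x : X, s x ∈ MaxMinMeasure.concentratedOn (f ⁻¹' {x})

open Set Filter Topology

/-! An upper semicontinuous density `d : X → [-∞, ∞]` attaining `∞` gives the max-min measure `φ ↦
max (d ∧ φ)`; its closed superlevel sets suffice to define it. Density of `J_ω`: for each `φ` some
point carries enough density to attain `μ φ` (`exists_attaining`), so finitely many points reproduce
`μ` on a finite set of functions. Surjectivity: a section `s` gives the averaging operator `T φ y =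
s y φ` with `T (φ ∘ f) = φ`, and `μ ∘ T` is a preimage of `μ`. Resolution: `Space X` lies in `X ×
2^C(X)`, and its bits determine the point. A density that drops as the signed coordinates grow makes
the fibre measures depend continuously on `x` (`exists_nearby_lift`). -/

theorem MaxMinMeasure.ext_toFun {X : Type u} [TopologicalSpace X] {μ ν : MaxMinMeasure X}
    (h : μ.toFun = ν.toFun) : μ = ν := by
  cases μ; cases ν; cases h; rfl

/-! ### Measures from densities -/

/-- The superlevel sets `{d ≥ a}` of an upper semicontinuous density `d : X → [-∞, ∞]` which takes
the value `∞`. -/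
structure LevelFamily (X : Type u) [TopologicalSpace X] where
  level : ℝ → Set X
  closed : ∀ a, IsClosed (level a)
  nonempty : ∀ a, (level a).Nonempty
  anti : Antitone level
  mem_of_forall_lt : ∀ a x, (∀ b < a, x ∈ level b) → x ∈ level a

namespace LevelFamily

variable {X : Type u} [TopologicalSpace X]

/-- The value `max_x (d x ∧ φ x)`. -/
noncomputable def value (K : LevelFamily X) (φ : C(X, ℝ)) : ℝ :=
  sSup {a : ℝ | ∃ x ∈ K.level a, a ≤ φ x}

variable [CompactSpace X]

/-- Compactness makes the supremum a maximum: the sets `level b ∩ {b ≤ φ}`, `b < a`, are closed,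
nonempty and nested. The measure axioms then become statements about `∃`. -/
theorem le_value_iff (K : LevelFamily X) (φ : C(X, ℝ)) (a : ℝ) :
    a ≤ K.value φ ↔ ∃ x ∈ K.level a, a ≤ φ x := by
  have hbound : ∀ x, |φ x| ≤ ‖φ‖ := fun x => φ.norm_coe_le_norm x
  have hbdd : BddAbove {a : ℝ | ∃ x ∈ K.level a, a ≤ φ x} :=
    ⟨‖φ‖, fun b ⟨x, _, hx⟩ => hx.trans ((le_abs_self _).trans (hbound x))⟩
  have hne : {a : ℝ | ∃ x ∈ K.level a, a ≤ φ x}.Nonempty := by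
    obtain ⟨x, hx⟩ := K.nonempty (-‖φ‖)
    exact ⟨-‖φ‖, x, hx, (abs_le.1 (hbound x)).1⟩
  refine ⟨fun h => ?_, fun h => le_csSup hbdd h⟩
  let t : Iio a → Set X := fun b => K.level b ∩ {x | (b : ℝ) ≤ φ x}
  have hclosed : ∀ b, IsClosed (t b) := fun b =>
    (K.closed b).inter (isClosed_le continuous_const φ.continuous)
  have hanti : Antitone t := fun b c hbc x hx =>
    ⟨K.anti (show (b : ℝ) ≤ c from hbc) hx.1, (show (b : ℝ) ≤ c from hbc).trans hx.2⟩
  obtain ⟨x, hx⟩ := IsCompact.nonempty_iInter_of_directed_nonempty_isCompact_isClosed t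
    hanti.directed_ge
    (fun b => by
      obtain ⟨c, ⟨x, hxK, hxc⟩, hbc⟩ := exists_lt_of_lt_csSup hne (lt_of_lt_of_le b.2 h)
      exact ⟨x, K.anti hbc.le hxK, hbc.le.trans hxc⟩)
    (fun b => (hclosed b).isCompact) hclosed
  rw [mem_iInter] at hx
  exact ⟨x, K.mem_of_forall_lt a x fun b hb => (hx ⟨b, hb⟩).1,
    le_of_forall_lt_imp_le_of_dense fun b hb => (hx ⟨b, hb⟩).2⟩

/-- The max-min measure with given superlevel sets of its density. -/
noncomputable def measure (K : LevelFamily X) : MaxMinMeasure X where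
  toFun := K.value
  map_const' c := eq_of_forall_le_iff fun a => by
    rw [le_value_iff]
    exact ⟨fun ⟨_, _, h⟩ => h, fun h => (K.nonempty a).imp fun x hx => ⟨hx, h⟩⟩
  map_sup' φ ψ := eq_of_forall_le_iff fun a => by
    simp only [le_value_iff, le_sup_iff, ContinuousMap.sup_apply, and_or_left, exists_or]
  map_const_inf' c φ := eq_of_forall_le_iff fun a => by
    simp only [le_value_iff, le_inf_iff, ContinuousMap.inf_apply, ContinuousMap.const_apply]
    exact ⟨fun ⟨x, hx, h, h'⟩ => ⟨h, x, hx, h'⟩, fun ⟨h, x, hx, h'⟩ => ⟨x, hx, h, h'⟩⟩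

theorem le_measure_iff (K : LevelFamily X) (φ : C(X, ℝ)) (a : ℝ) :
    a ≤ K.measure.toFun φ ↔ ∃ x ∈ K.level a, a ≤ φ x :=
  K.le_value_iff φ a

theorem measure_mem_concentratedOn (K : LevelFamily X) {A : Set X} (hA : IsClosed A)
    (h : ∀ a, K.level a ⊆ A) : K.measure ∈ MaxMinMeasure.concentratedOn A := by
  have : CompactSpace A := isCompact_iff_compactSpace.1 hA.isCompact
  let L : LevelFamily A :=
    { level := fun a => Subtype.val ⁻¹' K.level a
      closed := fun a => (K.closed a).preimage continuous_subtype_val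
      nonempty := fun a => by
        obtain ⟨x, hx⟩ := K.nonempty a
        exact ⟨⟨x, h a hx⟩, hx⟩
      anti := fun a b hab x hx => K.anti hab hx
      mem_of_forall_lt := fun a x hx => K.mem_of_forall_lt a x hx }
  refine ⟨L.measure, MaxMinMeasure.ext_toFun (funext fun φ => eq_of_forall_le_iff fun a => ?_)⟩
  change a ≤ L.measure.toFun _ ↔ _
  rw [le_measure_iff, le_measure_iff]
  exact ⟨fun ⟨x, hx, hφ⟩ => ⟨x, hx, hφ⟩, fun ⟨x, hx, hφ⟩ => ⟨⟨x, h a hx⟩, hx, hφ⟩⟩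

end LevelFamily

/-! ### Attaining points and finite supports -/

namespace MaxMinMeasure

variable {X : Type u} {Y : Type v} [TopologicalSpace X] [TopologicalSpace Y]

theorem mono (μ : MaxMinMeasure X) {φ ψ : C(X, ℝ)} (h : φ ≤ ψ) : μ.toFun φ ≤ μ.toFun ψ := by
  rw [← sup_eq_right.2 h, μ.map_sup']
  exact le_sup_left

/-- The value of `μ` at `φ` is attained at a point where the density of `μ` is at least `μ φ`. -/
theorem exists_attaining [CompactSpace X] (μ : MaxMinMeasure X) (φ : C(X, ℝ)) :
    ∃ x, μ.toFun φ ≤ φ x ∧ ∀ ψ, μ.toFun φ ⊓ ψ x ≤ μ.toFun ψ := by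
  by_contra! hcon
  have local_bound : ∀ x, ∃ g : C(X, ℝ), μ.toFun g < μ.toFun φ ∧ ∀ᶠ y in 𝓝 x, φ y ≤ g y := by
    intro x
    rcases lt_or_ge (φ x) (μ.toFun φ) with hx | hx
    · obtain ⟨c, hc, hc'⟩ := exists_between hx
      exact ⟨ContinuousMap.const X c, by rwa [μ.map_const'],
        (φ.continuous.continuousAt.eventually_lt_const hc).mono fun y hy => hy.le⟩
    · obtain ⟨ψ, hψ⟩ := hcon x hx
      obtain ⟨hψa, hψx⟩ := lt_inf_iff.1 hψ
      obtain ⟨c, hc, hcx⟩ := exists_between hψx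
      let m : ℝ := -‖ψ‖
      have hm : ∀ y, m ≤ ψ y := fun y => (abs_le.1 (ψ.norm_coe_le_norm y)).1
      have hpos : 0 < ψ x - c := sub_pos.2 hcx
      let L : ℝ := (φ x - m + 1) / (ψ x - c)
      -- Equals `m ≤ ψ` where `ψ ≤ c`, and `φ x + 1` at `x`. Hence `c ∧ g ≤ ψ`, and `μ ψ < c` forces
      -- `μ g ≤ μ ψ`.
      let g : C(X, ℝ) := ⟨fun y => m + L * max (ψ y - c) 0, by fun_prop⟩
      have hg : φ x < g x := by
        change φ x < m + L * max (ψ x - c) 0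
        rw [max_eq_left hpos.le, div_mul_cancel₀ _ hpos.ne']
        linarith
      have hle : ContinuousMap.const X c ⊓ g ≤ ψ := by
        intro y
        rcases le_total (ψ y) c with hy | hy
        · refine inf_le_right.trans ?_
          change m + L * max (ψ y - c) 0 ≤ ψ y
          rw [max_eq_right (by linarith), mul_zero, add_zero]
          exact hm y
        · exact inf_le_left.trans hy
      have h1 := μ.mono hle
      rw [μ.map_const_inf'] at h1
      refine ⟨g, ?_, (φ.continuous.continuousAt.eventually_lt g.continuous.continuousAt hg).mono
        fun y hy => hy.le⟩
      rcases inf_le_iff.1 h1 with h2 | h2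
      · exact absurd h2 hc.not_ge
      · exact h2.trans_lt hψa
  obtain ⟨g, hg, hφg⟩ : ∃ g : C(X, ℝ), μ.toFun g < μ.toFun φ ∧ ∀ y ∈ (univ : Set X), φ y ≤ g y := by
    refine isCompact_univ.induction_on
      (p := fun s => ∃ g : C(X, ℝ), μ.toFun g < μ.toFun φ ∧ ∀ y ∈ s, φ y ≤ g y) ?_ ?_ ?_ ?_
    · exact ⟨ContinuousMap.const X (μ.toFun φ - 1), by rw [μ.map_const']; linarith,
        fun y hy => hy.elim⟩
    · rintro s t hst ⟨g, hg, h⟩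
      exact ⟨g, hg, fun y hy => h y (hst hy)⟩
    · rintro s t ⟨g, hg, h⟩ ⟨g', hg', h'⟩
      refine ⟨g ⊔ g', by rw [μ.map_sup']; exact sup_lt_iff.2 ⟨hg, hg'⟩, fun y hy => ?_⟩
      exact hy.elim (fun hy => (h y hy).trans le_sup_left) fun hy => (h' y hy).trans le_sup_right
    · intro x _
      obtain ⟨g, hg, h⟩ := local_bound x
      exact ⟨_, mem_nhdsWithin_of_mem_nhds h, g, hg, fun y hy => hy⟩
  exact (μ.mono (show φ ≤ g from fun y => hφg y (mem_univ y))).not_gt hg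

/-- Every max-min measure agrees with one of finite support on any given finite set of
functions. -/
theorem exists_finiteSupport_eq [CompactSpace X] [T1Space X] (μ : MaxMinMeasure X)
    (F : Finset C(X, ℝ)) :
    ∃ ν ∈ finiteSupport X, ∀ φ ∈ F, ν.toFun φ = μ.toFun φ := by
  choose p hp hp' using μ.exists_attaining
  -- A common upper bound on `F`: density at least `c` acts on `F` like `∞`, so `x₀` can be put in
  -- every level.
  let c : ℝ := ∑ φ ∈ F, ‖φ‖
  have hc : ∀ φ ∈ F, ∀ x, φ x ≤ c := fun φ hφ x =>
    (le_abs_self _).trans ((φ.norm_coe_le_norm x).trans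
      (Finset.single_le_sum (f := fun φ : C(X, ℝ) => ‖φ‖) (fun _ _ => norm_nonneg _) hφ))
  let x₀ := p (ContinuousMap.const X c)
  have hx₀ : ∀ φ ∈ F, φ x₀ ≤ μ.toFun φ := fun φ hφ => by
    have h := hp' (ContinuousMap.const X c) φ
    rwa [μ.map_const', inf_eq_right.2 (hc φ hφ _)] at h
  let A : Set X := insert x₀ (p '' F)
  have hA : A.Finite := (F.finite_toSet.image p).insert x₀
  let K : LevelFamily X :=
    { level := fun a => insert x₀ (p '' {φ | φ ∈ F ∧ a ≤ μ.toFun φ})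
      closed := fun a => (hA.subset (insert_subset_insert
        (image_mono fun φ hφ => hφ.1))).isClosed
      nonempty := fun a => insert_nonempty _ _
      anti := fun a b hab => insert_subset_insert
        (image_mono fun φ hφ => ⟨hφ.1, hab.trans hφ.2⟩)
      mem_of_forall_lt := by
        intro a x h
        by_contra hx
        have hlt : ∀ φ ∈ F, p φ = x → μ.toFun φ < a := fun φ hφ hφx => by
          by_contra! hle
          exact hx (Or.inr ⟨φ, ⟨hφ, hle⟩, hφx⟩)
        -- Only finitely many thresholds `μ φ < a` occur, so some `b < a` exceeds them all.
        have hev : ∀ᶠ b in 𝓝[<] a, ∀ φ ∈ F, p φ = x → μ.toFun φ < b := by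
          rw [Filter.eventually_all_finset]
          intro φ hφ
          by_cases hφx : p φ = x
          · exact ((eventually_gt_nhds (hlt φ hφ hφx)).filter_mono nhdsWithin_le_nhds).mono
              fun b hb _ => hb
          · exact Eventually.of_forall fun b hb => absurd hb hφx
        obtain ⟨b, hb, hba⟩ := (hev.and self_mem_nhdsWithin).exists
        rcases h b hba with hx₀ | ⟨φ, ⟨hφ, hbφ⟩, hφx⟩
        · exact hx (Or.inl hx₀)
        · exact (hb φ hφ hφx).not_ge hbφ }
  refine ⟨K.measure, hA.subset (sInter_subset_of_mem ⟨insert_nonempty _ _, hA.isCompact,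
    K.measure_mem_concentratedOn hA.isClosed fun a => insert_subset_insert
      (image_mono fun φ hφ => hφ.1)⟩), fun φ hφ => eq_of_forall_le_iff fun a => ?_⟩
  rw [K.le_measure_iff]
  constructor
  · rintro ⟨x, rfl | ⟨ψ, ⟨_, hψ⟩, rfl⟩, hx⟩
    · exact hx.trans (hx₀ φ hφ)
    · exact (le_inf hψ hx).trans (hp' ψ φ)
  · exact fun h => ⟨p φ, Or.inr ⟨φ, ⟨hφ, h⟩, rfl⟩, h.trans (hp φ)⟩

theorem dense_finiteSupport [CompactSpace X] [T1Space X] : Dense (finiteSupport X) := by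
  intro μ
  rw [mem_closure_iff]
  intro o ho hμ
  obtain ⟨V, hV, rfl⟩ := isOpen_induced_iff.1 ho
  obtain ⟨F, U, hU, hsub⟩ := isOpen_pi_iff.1 hV _ hμ
  obtain ⟨ν, hν, h⟩ := μ.exists_finiteSupport_eq F
  refine ⟨ν, hsub fun φ hφ => ?_, hν⟩
  change ν.toFun φ ∈ U φ
  rw [h φ hφ]
  exact (hU φ hφ).2

/-! ### Surjectivity for Milyutin maps -/

theorem apply_comp_of_mem_concentratedOn (f : C(X, Y)) {y : Y} {μ : MaxMinMeasure X}
    (h : μ ∈ concentratedOn (f ⁻¹' {y})) (φ : C(Y, ℝ)) : μ.toFun (φ.comp f) = φ y := by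
  obtain ⟨ν, rfl⟩ := h
  rw [← ν.map_const' (φ y)]
  exact congrArg ν.toFun (ContinuousMap.ext fun x => congrArg φ x.2)

theorem continuous_apply (φ : C(X, ℝ)) : Continuous fun μ : MaxMinMeasure X => μ.toFun φ :=
  (_root_.continuous_apply φ).comp continuous_induced_dom

theorem map_surjective_of_isMaxMinMilyutin {f : C(X, Y)} (hf : IsMaxMinMilyutin f) :
    Function.Surjective (map f) := by
  obtain ⟨s, hs, hsf⟩ := hf
  intro μ
  let T : C(X, ℝ) → C(Y, ℝ) := fun φ => ⟨fun y => (s y).toFun φ, (continuous_apply φ).comp hs⟩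
  refine ⟨⟨fun φ => μ.toFun (T φ), fun c => ?_, fun φ ψ => ?_, fun c φ => ?_⟩, ?_⟩
  · exact (congrArg μ.toFun (ContinuousMap.ext fun y => (s y).map_const' c)).trans (μ.map_const' c)
  · rw [← μ.map_sup']
    exact congrArg μ.toFun (ContinuousMap.ext fun y => (s y).map_sup' φ ψ)
  · rw [← μ.map_const_inf']
    exact congrArg μ.toFun (ContinuousMap.ext fun y => (s y).map_const_inf' c φ)
  · exact ext_toFun (funext fun φ => congrArg μ.toFun
      (ContinuousMap.ext fun y => apply_comp_of_mem_concentratedOn f (hsf y) φ))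

end MaxMinMeasure

/-! ### The zero-dimensional resolution -/

namespace MilyutinResolution

variable {X : Type u} [TopologicalSpace X]

/-- The coordinate `φ` up to the sign `ε φ`. -/
def signed (φ : C(X, ℝ)) (z : X × (C(X, ℝ) → Bool)) : ℝ :=
  if z.2 φ then -φ z.1 else φ z.1

theorem continuous_signed (φ : C(X, ℝ)) : Continuous (signed φ) := by
  have h : Continuous fun p : ℝ × Bool => if p.2 then -p.1 else p.1 := by
    rw [continuous_prod_of_discrete_right]
    intro b
    cases b <;> simp <;> fun_prop
  exact h.comp (by fun_prop : Continuous fun z : X × (C(X, ℝ) → Bool) => (φ z.1, z.2 φ))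

/-- The resolution of `X`: points of `X` with a choice, for every `φ`, of one of the overlapping
closed sets `{φ ≤ 1}` and `{-1 ≤ φ}` that contains the point. -/
def Space (X : Type u) [TopologicalSpace X] : Type u :=
  {z : X × (C(X, ℝ) → Bool) // ∀ φ, signed φ z ≤ 1}

instance : TopologicalSpace (Space X) :=
  inferInstanceAs (TopologicalSpace {z : X × (C(X, ℝ) → Bool) // ∀ φ, signed φ z ≤ 1})

instance [T2Space X] : T2Space (Space X) :=
  inferInstanceAs (T2Space {z : X × (C(X, ℝ) → Bool) // ∀ φ, signed φ z ≤ 1})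

instance [CompactSpace X] : CompactSpace (Space X) := by
  refine isCompact_iff_compactSpace.1 (IsClosed.isCompact (s := {z | ∀ φ, signed φ z ≤ 1}) ?_)
  simp only [ofPred_forall]
  exact isClosed_iInter fun φ => isClosed_le (continuous_signed φ) continuous_const

theorem continuous_val : Continuous (Subtype.val : Space X → X × (C(X, ℝ) → Bool)) :=
  continuous_subtype_val

/-- The projection of the resolution. -/
def proj : C(Space X, X) := ⟨fun z => z.1.1, continuous_fst.comp continuous_val⟩

/-- A Urysohn function rescaled to be `-2` at one point and `2` at the other forces opposite bits,
since `|ψ| > 1` leaves only one admissible sign. -/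
theorem choice_injective [CompactSpace X] [T2Space X] :
    Function.Injective fun z : Space X => z.1.2 := by
  intro z w h
  refine Subtype.ext (Prod.ext ?_ h)
  by_contra hne
  obtain ⟨φ, h0, h1, -⟩ := exists_continuous_zero_one_of_isClosed (isClosed_singleton (x := z.1.1))
    (isClosed_singleton (x := w.1.1)) (by simpa using hne)
  let ψ : C(X, ℝ) := ⟨fun y => 4 * φ y - 2, by fun_prop⟩
  have hz : ψ z.1.1 = -2 := by
    change 4 * φ z.1.1 - 2 = -2
    rw [h0 rfl]; norm_num
  have hw : ψ w.1.1 = 2 := by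
    change 4 * φ w.1.1 - 2 = 2
    rw [h1 rfl]; norm_num
  have h2 := z.2 ψ
  have h3 := w.2 ψ
  have h4 : z.1.2 ψ = w.1.2 ψ := congrFun h ψ
  unfold signed at h2 h3
  rw [h4, hz] at h2
  rw [hw] at h3
  split_ifs at h2 h3 <;> linarith

theorem isZeroDimensional [CompactSpace X] [T2Space X] : IsZeroDimensional (Space X) := by
  have : TotallyDisconnectedSpace (Space X) := ⟨isTotallyDisconnected_of_image
    (continuous_snd.comp continuous_val).continuousOn choice_injective
    (isTotallyDisconnected_of_totallyDisconnectedSpace _)⟩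
  exact ⟨_, isTopologicalBasis_isClopen, fun U hU => hU⟩

/-- The points of the resolution at which the density is at least `a`: the density is the infimum
of strictly decreasing functions of the signed coordinates, infinite at nonpositive values. -/
def superlevel (X : Type u) [TopologicalSpace X] (a : ℝ) : Set (Space X) :=
  {z | ∀ φ, signed φ z.1 ≤ Real.sigmoid (-a)}

theorem isClosed_superlevel (a : ℝ) : IsClosed (superlevel X a) := by
  simp only [superlevel, ofPred_forall]
  exact isClosed_iInter fun φ =>
    isClosed_le ((continuous_signed φ).comp continuous_val) continuous_const

theorem superlevel_antitone : Antitone (superlevel X) := fun _ _ hab _ hz φ =>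
  (hz φ).trans (Real.sigmoid_le (neg_le_neg hab))

/-- The choice at `x` that agrees with `ε` on `F` and has nonpositive signed coordinates
elsewhere. -/
noncomputable def adjust (F : Set C(X, ℝ)) (ε : C(X, ℝ) → Bool) (x : X) : C(X, ℝ) → Bool :=
  open Classical in fun φ => if φ ∈ F then ε φ else decide (0 ≤ φ x)

theorem signed_adjust_nonpos {F : Set C(X, ℝ)} {φ : C(X, ℝ)} (hφ : φ ∉ F)
    (ε : C(X, ℝ) → Bool) (x : X) : signed φ (x, adjust F ε x) ≤ 0 := by
  by_cases h : 0 ≤ φ x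
  · simp [signed, adjust, hφ, h]
  · simp [signed, adjust, hφ, h, (not_le.1 h).le]

theorem signed_adjust_of_mem {F : Set C(X, ℝ)} {φ : C(X, ℝ)} (hφ : φ ∈ F)
    (ε : C(X, ℝ) → Bool) (x : X) : signed φ (x, adjust F ε x) = signed φ (x, ε) := by
  simp [signed, adjust, hφ]

/-- Lowering the level from `b` to `a` makes the bounds strict, so the finitely many bits seen by
`U` stay admissible near `proj z`. All other bits are reset to give nonpositive coordinates, which
are allowed at every level because `Real.sigmoid` is nonnegative. -/
theorem exists_nearby_lift {z : Space X} {a b : ℝ} (hab : a < b) (hz : z ∈ superlevel X b)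
    {U : Set (Space X)} (hU : U ∈ 𝓝 z) :
    ∀ᶠ x in 𝓝 (proj z), ∃ w ∈ U, w ∈ superlevel X a ∧ proj w = x := by
  obtain ⟨O, hO, hOU⟩ := mem_nhds_induced _ z U |>.1 hU
  obtain ⟨V, hV, W, hW, hVW⟩ := mem_nhds_prod_iff.1 hO
  obtain ⟨W', hW'W, hW'o, hzW'⟩ := mem_nhds_iff.1 hW
  obtain ⟨F, u, hu, hsub⟩ := isOpen_pi_iff.1 hW'o _ hzW'
  have hF : ∀ᶠ x in 𝓝 z.1.1, ∀ φ ∈ F, signed φ (x, z.1.2) < Real.sigmoid (-a) := by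
    rw [Filter.eventually_all_finset]
    intro φ _
    have hcont : Continuous fun x => signed φ (x, z.1.2) :=
      (continuous_signed φ).comp (by fun_prop)
    exact hcont.continuousAt.eventually_lt_const
      ((hz φ).trans_lt (Real.sigmoid_lt (neg_lt_neg hab)))
  change ∀ᶠ x in 𝓝 z.1.1, _
  filter_upwards [hF, hV] with x hxF hxV
  have hle : ∀ φ, signed φ (x, adjust F z.1.2 x) ≤ Real.sigmoid (-a) := by
    intro φ
    by_cases hφ : φ ∈ (F : Set C(X, ℝ))
    · rw [signed_adjust_of_mem hφ]
      exact (hxF φ hφ).le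
    · exact (signed_adjust_nonpos hφ _ x).trans (Real.sigmoid_nonneg _)
  refine ⟨⟨(x, adjust F z.1.2 x), fun φ => (hle φ).trans (Real.sigmoid_le_one _)⟩,
    hOU (hVW ⟨hxV, hW'W (hsub fun φ hφ => ?_)⟩), hle, rfl⟩
  have h : adjust (F : Set C(X, ℝ)) z.1.2 x φ = z.1.2 φ := by
    simp only [adjust, if_pos hφ]
  change adjust (F : Set C(X, ℝ)) z.1.2 x φ ∈ u φ
  rw [h]
  exact (hu φ hφ).2

variable [T1Space X]

/-- The superlevel sets of the density on the fibre over `x`. -/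
noncomputable def fibreFamily (x : X) : LevelFamily (Space X) where
  level a := superlevel X a ∩ proj ⁻¹' {x}
  closed a := (isClosed_superlevel a).inter (isClosed_singleton.preimage proj.continuous)
  nonempty a := by
    have h : ∀ φ, signed φ (x, adjust ∅ (fun _ => true) x) ≤ 0 := fun φ =>
      signed_adjust_nonpos (notMem_empty φ) _ x
    exact ⟨⟨(x, adjust ∅ (fun _ => true) x), fun φ => (h φ).trans zero_le_one⟩,
      fun φ => (h φ).trans (Real.sigmoid_nonneg _), rfl⟩
  anti a b hab := inter_subset_inter_left _ (superlevel_antitone hab)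
  mem_of_forall_lt a z h := by
    refine ⟨fun φ => ?_, (h (a - 1) (sub_one_lt a)).2⟩
    have hcont : Continuous fun b : ℝ => Real.sigmoid (-b) :=
      continuous_sigmoid.comp continuous_neg
    exact ge_of_tendsto (x := 𝓝[<] a) (hcont.continuousAt.tendsto.mono_left nhdsWithin_le_nhds)
      (eventually_mem_nhdsWithin.mono fun b hb => (h b hb).1 φ)

/-- Lower semicontinuity comes from lifting nearby points; upper semicontinuity holds because `{x |
a ≤ s x φ}` is the projection of a compact set. -/
theorem isMaxMinMilyutin_proj [CompactSpace X] [T2Space X] :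
    IsMaxMinMilyutin (proj : C(Space X, X)) := by
  refine ⟨fun x => (fibreFamily x).measure, ?_, fun x =>
    (fibreFamily x).measure_mem_concentratedOn (isClosed_singleton.preimage proj.continuous)
      fun a => inter_subset_right⟩
  refine continuous_induced_rng.2 (continuous_pi fun φ =>
    continuous_iff_lower_upperSemicontinuous.2 ⟨?_, ?_⟩)
  · intro x a ha
    obtain ⟨b, hab, hb⟩ := exists_between (show a < (fibreFamily x).measure.toFun φ from ha)
    obtain ⟨z, ⟨hz, hzx⟩, hbz⟩ := ((fibreFamily x).le_measure_iff φ b).1 hb.le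
    obtain ⟨c, hac, hcb⟩ := exists_between hab
    obtain rfl : proj z = x := hzx
    filter_upwards [exists_nearby_lift hcb hz
      (φ.continuous.continuousAt.eventually_const_lt (hcb.trans_le hbz))]
    rintro x ⟨w, hw, hwc, hwx⟩
    exact hac.trans_le (((fibreFamily x).le_measure_iff φ c).2 ⟨w, ⟨hwc, hwx⟩, le_of_lt hw⟩)
  · rw [upperSemicontinuous_iff_isClosed_preimage]
    intro a
    have h : (fun x : X => (fibreFamily x).measure.toFun φ) ⁻¹' Ici a =
        proj '' (superlevel X a ∩ {z | a ≤ φ z}) := by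
      ext x
      rw [mem_preimage, mem_Ici, LevelFamily.le_measure_iff]
      exact ⟨fun ⟨z, ⟨hz, hzx⟩, hφ⟩ => ⟨z, ⟨hz, hφ⟩, hzx⟩,
        fun ⟨z, ⟨hz, hφ⟩, hzx⟩ => ⟨z, ⟨hz, hzx⟩, hφ⟩⟩
    exact h ▸ (((isClosed_superlevel a).inter
      (isClosed_le continuous_const φ.continuous)).isCompact.image proj.continuous).isClosed

end MilyutinResolution

theorem mainTheorem3 (X : Type u) [TopologicalSpace X] [CompactSpace X] [T2Space X] :
    (∃ (Z : Type u) (_ : TopologicalSpace Z) (_ : CompactSpace Z) (_ : T2Space Z) (f : C(Z, X)),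
      IsZeroDimensional Z ∧ IsMaxMinMilyutin f) ∧
    (∀ (Z : Type v) [TopologicalSpace Z] [CompactSpace Z] [T2Space Z] (f : C(Z, X)),
      IsMaxMinMilyutin f → Function.Surjective (MaxMinMeasure.map f)) ∧
    Dense (MaxMinMeasure.finiteSupport X) :=
  ⟨⟨MilyutinResolution.Space X, inferInstance, inferInstance, inferInstance,
    MilyutinResolution.proj, MilyutinResolution.isZeroDimensional,
    MilyutinResolution.isMaxMinMilyutin_proj⟩,
    fun _ _ _ _ _ hf => MaxMinMeasure.map_surjective_of_isMaxMinMilyutin hf,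
    MaxMinMeasure.dense_finiteSupport⟩
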